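/- **Theorem (equivariant HELP).** Let $M$ be a monoid. An $M$-space is a topological space with a left action of $M$ such that every element of $M$ acts continuously. An $M$-set $P$ is projective if every surjective $M$-equivariant map onto $P$ has an $M$-equivariant section; $M$-sets are regarded as discrete $M$-spaces, and the ball $B^q$, the sphere $S^{q-1}$ (empty for $q=0$) and $I=[0,1]$ carry the trivial action. A projective relative $M$-CW complex is a pair $(X,A)$, where $X$ is an $M$-space and $A\subseteq X$ an $M$-invariant subspace, together with $M$-invariant subspaces $A=X_{-1}\subseteq X_0\subseteq X_1\subseteq\cdots$ such that $X$ is the union of the $X_q$ with the colimit topology and, for every $q\ge 0$, $X_q$ is a pushout of $X_{q-1}\leftarrow P_q\times S^{q-1}\hookrightarrow P_q\times B^q$ in $M$-spaces, for some projective $M$-set $P_q$ and some continuous $M$-equivariant map $P_q\times S^{q-1}\to X_{q-1}$ (so $X_0$ is the disjoint union of $A$ and the discrete space $P_0$). It has dimension at most $n\in\mathbb N\cup\{\infty\}$ if $P_q=\emptyset$ for all $q>n$. A continuous map $k\colon Y\to Z$ is an $n$-equivalence if $k_*\colon\pi_q(Y,y)\to\pi_q(Z,k(y))$ is bijective for $0\le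 q<n$ and surjective for $q=n$ (if $n<\infty$), for all $y\in Y$; here, for $q=0$, the condition is on the map $\pi_0(Y)\to\pi_0(Z)$ between sets of path components (without base points, also if $Y=\emptyset$). Let $n\in\mathbb N\cup\{\infty\}$, let $(X,A)$ be a projective relative $M$-CW complex of dimension at most $n$ with inclusion $i\colon A\to X$, let $Y,Z$ be $M$-spaces and let $k\colon Y\to Z$ be a continuous $M$-equivariant map that is an $n$-equivalence. Let $f\colon X\to Z$, $g\colon A\to Y$ and $h\colon A\times I\to Z$ be continuous $M$-equivariant maps with $h(a,0)=f(a)$ and $h(a,1)=k(g(a))$ for all $a\in A$. Then there are continuous $M$-equivariant maps $\tilde g\colon X\to Y$ and $\tilde h\colon X\times I\to Z$ such that $\tilde g\circ i=g$, $\tilde h\circ(i\times \mathrm{id}_I)=h$, and $\tilde h(x,0)=f(x)$ and $\tilde h(x,1)=k(\tilde g(x))$ for all $x\in X$. -/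

import Mathlib

open Topology unitInterval

universe u v w

/-- An `M`-set `P` is projective if every surjective `M`-equivariant map onto `P` has an
`M`-equivariant section.  The universe `max u v` is large enough to contain the free `M`-set on the
set underlying `P`, so quantifying over larger universes would give the same notion. -/
def IsProjectiveMSet (M : Type u) [Monoid M] (P : Type v) [MulAction M P] : Prop :=
  ∀ (E : Type (max u v)) [MulAction M E] (f : E →[M] P), Function.Surjective f →
    ∃ s : P →[M] E, ∀ p, f (s p) = p

/-- The closed unit ball `B^n`. -/
abbrev UnitBall (n : ℕ) : Type := Metric.closedBall (0 : EuclideanSpace ℝ (Fin n)) 1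

/-- The unit sphere `S^{n-1}` in `ℝ^n`; it is empty for `n = 0`. -/
abbrev UnitSphere (n : ℕ) : Type := Metric.sphere (0 : EuclideanSpace ℝ (Fin n)) 1

/-- The inclusion `S^{n-1} → B^n`. -/
def sphereToBall (n : ℕ) : UnitSphere n → UnitBall n :=
  Set.inclusion Metric.sphere_subset_closedBall

/-- The commutative square
```
S --φ--> X
|        |
i        j
v        v
B --Φ--> Y
```
is a pushout square of topological spaces: `Y`, with `j` and `Φ`, is the quotient space of the
disjoint union `X ⊔ B` by the equivalence relation generated by `φ s ~ i s` for `s ∈ S`. -/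
structure IsPushoutOfSpaces {S B X Y : Type*} [TopologicalSpace B] [TopologicalSpace X]
    [TopologicalSpace Y] (φ : S → X) (i : S → B) (j : X → Y) (Φ : B → Y) : Prop where
  isQuotientMap : IsQuotientMap (Sum.elim j Φ)
  eq_iff : ∀ a b : X ⊕ B, Sum.elim j Φ a = Sum.elim j Φ b ↔
    Relation.EqvGen (fun a b => ∃ s, a = Sum.inl (φ s) ∧ b = Sum.inr (i s)) a b

/-- The structure of a projective relative `M`-CW complex on a pair `(X, A)`, where `X` is an
`M`-space and `A` is an `M`-invariant subspace.  The projective `M`-sets `cell n` are regarded as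
discrete spaces, and `M` acts on `cell n × B^n` and on `cell n × S^{n-1}` through the first
factor. -/
structure ProjectiveRelCW (M : Type u) [Monoid M] (X : Type v) [TopologicalSpace X]
    [MulAction M X] (A : SubMulAction M X) where
  /-- `skel n` is the `(n-1)`-skeleton, so `skel 0 = A` and `skel (n + 1)` is the `n`-skeleton.
  It carries the subspace topology of `X`. -/
  skel : ℕ → SubMulAction M X
  skel_zero : skel 0 = A
  skel_le_succ : ∀ n, skel n ≤ skel (n + 1)
  /-- The `M`-set of `n`-cells. -/
  cell : ℕ → Type w
  [topologicalSpace_cell : ∀ n, TopologicalSpace (cell n)]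
  [discreteTopology_cell : ∀ n, DiscreteTopology (cell n)]
  [mulAction_cell : ∀ n, MulAction M (cell n)]
  projective_cell : ∀ n, IsProjectiveMSet M (cell n)
  /-- The attaching maps of the `n`-cells. -/
  attach : ∀ n, cell n × UnitSphere n → skel n
  continuous_attach : ∀ n, Continuous (attach n)
  attach_smul : ∀ n (m : M) p s, attach n (m • p, s) = m • attach n (p, s)
  /-- The characteristic maps of the `n`-cells. -/
  char : ∀ n, cell n × UnitBall n → skel (n + 1)
  continuous_char : ∀ n, Continuous (char n)
  char_smul : ∀ n (m : M) p b, char n (m • p, b) = m • char n (p, b)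
  /-- The `n`-skeleton is obtained from the `(n-1)`-skeleton by attaching the `n`-cells.  For
  `n = 0` this says that it is the disjoint union of `A` and the discrete space `cell 0`. -/
  isPushout : ∀ n, IsPushoutOfSpaces (attach n) (Prod.map id (sphereToBall n))
    (Set.inclusion (skel_le_succ n)) (char n)
  /-- `X` is the union of its skeleta... -/
  exists_mem_skel : ∀ x, ∃ n, x ∈ skel n
  /-- ... with the colimit topology. -/
  isOpen_iff : ∀ U : Set X, IsOpen U ↔ ∀ n, IsOpen ((↑) ⁻¹' U : Set (skel n))

/-- The dimension is at most `n`: there are no cells of dimension greater than `n`. -/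
def ProjectiveRelCW.DimLE {M : Type u} [Monoid M] {X : Type v} [TopologicalSpace X]
    [MulAction M X] {A : SubMulAction M X} (K : ProjectiveRelCW.{u, v, w} M X A) (n : ℕ∞) : Prop :=
  ∀ q : ℕ, n < (q : ℕ∞) → IsEmpty (K.cell q)

/-- The map on sets of path components induced by a continuous map. -/
def piZeroMap {Y Z : Type*} [TopologicalSpace Y] [TopologicalSpace Z] (f : C(Y, Z)) :
    ZerothHomotopy Y → ZerothHomotopy Z :=
  Quotient.map f fun _ _ h => h.map f.continuous

/-- The map `π_q(Y, y) → π_q(Z, f y)` induced by a continuous map `f`. -/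
def piMap {Y Z : Type*} [TopologicalSpace Y] [TopologicalSpace Z] (q : ℕ) (f : C(Y, Z)) (y : Y) :
    HomotopyGroup.Pi q Y y → HomotopyGroup.Pi q Z (f y) :=
  Quotient.map (fun p => ⟨f.comp p.1, fun t ht => congrArg f (p.2 t ht)⟩)
    fun _ _ h => ContinuousMap.HomotopicRel.comp_continuousMap h f

/-- A continuous map is an `n`-equivalence, `0 ≤ n ≤ ∞`, if it induces a bijection on `π_q` for
`q < n` and a surjection for `q = n`, for all base points; on `π_0`, the set of path components,
no base point is involved. -/
structure IsNEquivalence {Y Z : Type*} [TopologicalSpace Y] [TopologicalSpace Z] (n : ℕ∞)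
    (f : C(Y, Z)) : Prop where
  bijective_zero : 0 < n → Function.Bijective (piZeroMap f)
  surjective_zero : n = 0 → Function.Surjective (piZeroMap f)
  bijective : ∀ q : ℕ, 1 ≤ q → (q : ℕ∞) < n → ∀ y : Y, Function.Bijective (piMap q f y)
  surjective : ∀ q : ℕ, 1 ≤ q → (q : ℕ∞) = n → ∀ y : Y, Function.Surjective (piMap q f y)

/-- The free `M`-set on a set `P`. -/
structure FreeMSet (M : Type u) (P : Type v) where
  scalar : M
  point : P

instance FreeMSet.instMulAction (M : Type u) [Monoid M] (P : Type v) :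
    MulAction M (FreeMSet M P) where
  smul m x := ⟨m * x.scalar, x.point⟩
  one_smul x := by
    change FreeMSet.mk (1 * x.scalar) x.point = x
    rw [one_mul]
  mul_smul a b x := by
    change FreeMSet.mk (a * b * x.scalar) x.point = FreeMSet.mk (a * (b * x.scalar)) x.point
    rw [mul_assoc]

/-- A projective `M`-set is an equivariant retract of the free `M`-set on its underlying set. -/
theorem IsProjectiveMSet.exists_retract {M : Type u} [Monoid M] {P : Type v} [MulAction M P]
    (hP : IsProjectiveMSet M P) :
    ∃ (μ : P → M) (ρ : P → P), (∀ p, μ p • ρ p = p) ∧ (∀ (m : M) p, μ (m • p) = m * μ p) ∧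
      ∀ (m : M) p, ρ (m • p) = ρ p := by
  obtain ⟨s, hs⟩ := hP (FreeMSet M P)
    { toFun := fun x => x.scalar • x.point
      map_smul' := fun m x => mul_smul m x.scalar x.point }
    (fun p => ⟨⟨1, p⟩, one_smul M p⟩)
  refine ⟨fun p => (s p).scalar, fun p => (s p).point, hs, fun m p => ?_, fun m p => ?_⟩
  · change (s (m • p)).scalar = _
    rw [map_smul]
    rfl
  · change (s (m • p)).point = _
    rw [map_smul]
    rfl

/-- The map `p` has the right lifting property with respect to `S^{q-1} → B^q`. -/
def LiftsCell {V Z : Type*} [TopologicalSpace V] [TopologicalSpace Z] (p : C(V, Z)) (q : ℕ) :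
    Prop :=
  ∀ (f : C(UnitBall q, Z)) (u : C(UnitSphere q, V)), (∀ s, p (u s) = f (sphereToBall q s)) →
    ∃ U : C(UnitBall q, V), (∀ s, U (sphereToBall q s) = u s) ∧ ∀ b, p (U b) = f b

namespace ProjectiveRelCW

variable {M : Type u} [Monoid M] {X : Type v} [TopologicalSpace X] [MulAction M X]
  {A : SubMulAction M X} {V Z : Type*} [TopologicalSpace V] [TopologicalSpace Z]
  [MulAction M V] [MulAction M Z] [ContinuousConstSMul M V]

theorem exists_lift_skel_succ (K : ProjectiveRelCW.{u, v, w} M X A) (n : ℕ) (p : C(V, Z))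
    (hp : ∀ (m : M) x, p (m • x) = m • p x) (hl : Nonempty (K.cell n) → LiftsCell p n)
    (f : C(X, Z)) (hf : ∀ (m : M) x, f (m • x) = m • f x) (u : C(K.skel n, V))
    (hu : ∀ (m : M) x, u (m • x) = m • u x) (hpu : ∀ x, p (u x) = f x) :
    ∃ U : C(K.skel (n + 1), V), (∀ (m : M) x, U (m • x) = m • U x) ∧ (∀ x, p (U x) = f x) ∧
      ∀ x, U (Set.inclusion (K.skel_le_succ n) x) = u x := by
  let _ := K.topologicalSpace_cell n
  have _ := K.discreteTopology_cell n
  let _ := K.mulAction_cell n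
  obtain ⟨μ, ρ, hμρ, hμ, hρ⟩ := (K.projective_cell n).exists_retract
  have hch : ∀ c, Continuous fun b => K.char n (c, b) :=
    fun c => (K.continuous_char n).comp (by fun_prop)
  have hat : ∀ c, Continuous fun b => K.attach n (c, b) :=
    fun c => (K.continuous_attach n).comp (by fun_prop)
  have hglue : ∀ c s, K.char n (c, sphereToBall n s) =
      Set.inclusion (K.skel_le_succ n) (K.attach n (c, s)) := fun c s =>
    (((K.isPushout n).eq_iff (Sum.inl (K.attach n (c, s))) (Sum.inr (c, sphereToBall n s))).2
      (.rel _ _ ⟨(c, s), rfl, rfl⟩)).symm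
  have key : ∀ c : K.cell n, ∃ ψ : C(UnitBall n, V),
      (∀ s, ψ (sphereToBall n s) = u (K.attach n (c, s))) ∧
      ∀ b, p (ψ b) = f (K.char n (c, b)) := fun c =>
    hl ⟨c⟩ (f.comp ⟨fun b => K.char n (c, b), continuous_subtype_val.comp (hch c)⟩)
      (u.comp ⟨_, hat c⟩) fun s => by
        change p (u (K.attach n (c, s))) = f (K.char n (c, sphereToBall n s))
        rw [hpu, hglue]
  choose ψ hψ hψf using key
  let χ : K.cell n × UnitBall n → V := fun x => μ x.1 • ψ (ρ x.1) x.2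
  have hχc : Continuous χ := by
    rw [continuous_prod_of_discrete_left]
    intro c
    exact ((ψ (ρ c)).continuous).const_smul (μ c)
  have hχs : ∀ c s, χ (c, sphereToBall n s) = u (K.attach n (c, s)) := fun c s => by
    change μ c • ψ (ρ c) (sphereToBall n s) = _
    rw [hψ, ← hu, ← K.attach_smul, hμρ]
  have hχf : ∀ x, p (χ x) = f (K.char n x) := by
    rintro ⟨c, b⟩
    change p (μ c • ψ (ρ c) b) = _
    rw [hp, hψf, ← hf, ← SubMulAction.val_smul, ← K.char_smul, hμρ]
  have hχm : ∀ (m : M) c b, χ (m • c, b) = m • χ (c, b) := fun m c b => by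
    change μ (m • c) • ψ (ρ (m • c)) b = m • μ c • ψ (ρ c) b
    rw [hμ, hρ, mul_smul]
  have hq := (K.isPushout n).isQuotientMap
  let w : C(K.skel n ⊕ K.cell n × UnitBall n, V) :=
    ⟨Sum.elim u χ, u.continuous.sumElim hχc⟩
  have hw : ∀ a b, Sum.elim (Set.inclusion (K.skel_le_succ n)) (K.char n) a =
      Sum.elim (Set.inclusion (K.skel_le_succ n)) (K.char n) b → w a = w b := fun a b hab => by
    have h := ((K.isPushout n).eq_iff a b).1 hab
    clear hab
    induction h with
    | rel _ _ h =>
      obtain ⟨⟨c, s⟩, rfl, rfl⟩ := h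
      exact (hχs c s).symm
    | refl => rfl
    | symm _ _ _ ih => exact ih.symm
    | trans _ _ _ _ _ ih ih' => exact ih.trans ih'
  let U : C(K.skel (n + 1), V) := hq.lift (f := ⟨_, hq.continuous⟩) w fun a b => hw a b
  have hU : ∀ a, U (Sum.elim (Set.inclusion (K.skel_le_succ n)) (K.char n) a) = w a :=
    fun a => DFunLike.congr_fun (hq.lift_comp (f := ⟨_, hq.continuous⟩) w fun a b => hw a b) a
  have hUl : ∀ x, U (Set.inclusion (K.skel_le_succ n) x) = u x := fun x => hU (Sum.inl x)
  have hUr : ∀ x, U (K.char n x) = χ x := fun x => hU (Sum.inr x)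
  refine ⟨U, fun m x => ?_, fun x => ?_, hUl⟩
  · obtain ⟨x | ⟨c, b⟩, rfl⟩ := hq.surjective x
    · change U (Set.inclusion (K.skel_le_succ n) (m • x)) =
        m • U (Set.inclusion (K.skel_le_succ n) x)
      rw [hUl, hUl, hu]
    · change U (m • K.char n (c, b)) = m • U (K.char n (c, b))
      rw [← K.char_smul, hUr, hUr, hχm]
  · obtain ⟨x | x, rfl⟩ := hq.surjective x
    · change p (U (Set.inclusion (K.skel_le_succ n) x)) = f x
      rw [hUl, hpu]
    · change p (U (K.char n x)) = f (K.char n x)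
      rw [hUr, hχf]

theorem skel_mono (K : ProjectiveRelCW.{u, v, w} M X A) : Monotone K.skel :=
  monotone_nat_of_le_succ K.skel_le_succ

/-- An equivariant map with the right lifting property with respect to `S^{q-1} → B^q`, for all
`q` in which a projective relative `M`-CW complex has cells, has the equivariant right lifting
property with respect to this complex. -/
theorem exists_lift (K : ProjectiveRelCW.{u, v, w} M X A) (p : C(V, Z))
    (hp : ∀ (m : M) x, p (m • x) = m • p x) (hl : ∀ n, Nonempty (K.cell n) → LiftsCell p n)
    (f : C(X, Z)) (hf : ∀ (m : M) x, f (m • x) = m • f x) (u : C(A, V))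
    (hu : ∀ (m : M) x, u (m • x) = m • u x) (hpu : ∀ x, p (u x) = f x) :
    ∃ U : C(X, V), (∀ (m : M) x, U (m • x) = m • U x) ∧ (∀ x, p (U x) = f x) ∧
      ∀ x : A, U x = u x := by
  have h0 : ∀ x, x ∈ K.skel 0 → x ∈ A := fun x hx => K.skel_zero ▸ hx
  let L : ℕ → Type _ := fun n => {U : C(K.skel n, V) //
    (∀ (m : M) x, U (m • x) = m • U x) ∧ ∀ x, p (U x) = f x}
  have step : ∀ n (U : L n), ∃ U' : L (n + 1),
      ∀ x, U'.1 (Set.inclusion (K.skel_le_succ n) x) = U.1 x := fun n U => by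
    obtain ⟨U', h1, h2, h3⟩ := K.exists_lift_skel_succ n p hp (hl n) f hf U.1 U.2.1 U.2.2
    exact ⟨⟨U', h1, h2⟩, h3⟩
  choose next hnext using step
  let L0 : L 0 := ⟨u.comp ⟨Set.inclusion h0, continuous_inclusion h0⟩,
    fun m x => hu m (Set.inclusion h0 x), fun x => hpu (Set.inclusion h0 x)⟩
  let F : ∀ n, L n := fun n => Nat.rec L0 next n
  have hF : ∀ n m (hnm : n ≤ m) x (hx : x ∈ K.skel n),
      (F m).1 ⟨x, K.skel_mono hnm hx⟩ = (F n).1 ⟨x, hx⟩ := fun n m hnm => by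
    induction m, hnm using Nat.le_induction with
    | base => exact fun _ _ => rfl
    | succ m hnm ih => exact fun x hx => (hnext m (F m) ⟨x, K.skel_mono hnm hx⟩).trans (ih x hx)
  choose N hN using K.exists_mem_skel
  let U : X → V := fun x => (F (N x)).1 ⟨x, hN x⟩
  have hU : ∀ n x (hx : x ∈ K.skel n), U x = (F n).1 ⟨x, hx⟩ := fun n x hx => by
    rcases le_total n (N x) with h | h
    · exact hF _ _ h x hx
    · exact (hF _ _ h x (hN x)).symm
  have hUc : Continuous U := by
    refine ⟨fun O hO => (K.isOpen_iff _).2 fun n => ?_⟩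
    have : ((↑) ⁻¹' (U ⁻¹' O) : Set (K.skel n)) = (F n).1 ⁻¹' O := by
      ext x
      exact iff_of_eq (congrArg (· ∈ O) (hU n x x.2))
    rw [this]
    exact hO.preimage (F n).1.continuous
  refine ⟨⟨U, hUc⟩, fun m x => ?_, fun x => (F (N x)).2.2 ⟨x, hN x⟩, fun x => ?_⟩
  · change U (m • x) = m • U x
    rw [hU (N x) (m • x) ((K.skel (N x)).smul_mem m (hN x))]
    exact (F (N x)).2.1 m ⟨x, hN x⟩
  · exact hU 0 x (K.skel_zero.symm ▸ x.2)

end ProjectiveRelCW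

namespace UnitBall

/-- The radial retraction of `ℝ^n` onto the unit ball. -/
noncomputable def proj (n : ℕ) : C(EuclideanSpace ℝ (Fin n), UnitBall n) where
  toFun x := ⟨(max 1 ‖x‖)⁻¹ • x, by
    have h : (0 : ℝ) < max 1 ‖x‖ := lt_of_lt_of_le one_pos (le_max_left _ _)
    rw [mem_closedBall_zero_iff, norm_smul, norm_inv, Real.norm_of_nonneg h.le,
      inv_mul_le_iff₀ h, mul_one]
    exact le_max_right _ _⟩
  continuous_toFun := by
    refine Continuous.subtype_mk (Continuous.smul (Continuous.inv₀ (continuous_const.max continuous_norm)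
      fun x => ?_) continuous_id) _
    exact (lt_of_lt_of_le one_pos (le_max_left _ _)).ne'

theorem proj_of_norm_le {n : ℕ} {x : EuclideanSpace ℝ (Fin n)} (hx : ‖x‖ ≤ 1) :
    proj n x = ⟨x, mem_closedBall_zero_iff.2 hx⟩ :=
  Subtype.ext (by simp [proj, max_eq_left hx])

theorem proj_coe {n : ℕ} (x : UnitBall n) : proj n x = x :=
  proj_of_norm_le (mem_closedBall_zero_iff.1 x.2)

theorem proj_smul_sphere {n : ℕ} (s : UnitSphere n) {r : ℝ} (hr : 1 ≤ r) :
    proj n (r • (s : EuclideanSpace ℝ (Fin n))) = sphereToBall n s := by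
  have hs : ‖(s : EuclideanSpace ℝ (Fin n))‖ = 1 := mem_sphere_zero_iff_norm.1 s.2
  refine Subtype.ext ?_
  change (max 1 ‖r • (s : EuclideanSpace ℝ (Fin n))‖)⁻¹ • r • (s : EuclideanSpace ℝ (Fin n)) = s
  rw [norm_smul, hs, mul_one, Real.norm_of_nonneg (zero_le_one.trans hr), max_eq_right hr,
    smul_smul, inv_mul_cancel₀ (by positivity), one_smul]

theorem exists_eq_norm_smul {n : ℕ} {x : EuclideanSpace ℝ (Fin n)} (hx : x ≠ 0) :
    ∃ s : UnitSphere n, x = ‖x‖ • (s : EuclideanSpace ℝ (Fin n)) :=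
  ⟨⟨‖x‖⁻¹ • x, by simp [norm_smul, hx]⟩, by simp [smul_smul, hx]⟩

/-- A map on the unit ball and a homotopy of its restriction to the unit sphere fit together to
a map on `ℝ^n`, with the homotopy in the radial direction. -/
theorem exists_extend_collar {n : ℕ} {W : Type*} [TopologicalSpace W] (a : C(UnitBall n, W))
    (b : C(UnitSphere n × I, W)) (hab : ∀ s, b (s, 0) = a (sphereToBall n s)) :
    ∃ F : C(EuclideanSpace ℝ (Fin n), W), (∀ x : UnitBall n, F x = a x) ∧
      ∀ (s : UnitSphere n) (t : I), F ((1 + t : ℝ) • (s : EuclideanSpace ℝ (Fin n))) = b (s, t) := by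
  classical
  let β : {x : EuclideanSpace ℝ (Fin n) // 1 ≤ ‖x‖} → W := fun x =>
    b (⟨‖x.1‖⁻¹ • x.1, by
      have : ‖x.1‖ ≠ 0 := (lt_of_lt_of_le one_pos x.2).ne'
      simp [norm_smul, this]⟩, Set.projIcc 0 1 zero_le_one (‖x.1‖ - 1))
  have hβ : Continuous β := by
    refine b.continuous.comp (Continuous.prodMk (Continuous.subtype_mk (Continuous.smul
      (Continuous.inv₀ continuous_subtype_val.norm fun x => ?_) continuous_subtype_val) _)
      (continuous_projIcc.comp (by fun_prop)))
    exact (lt_of_lt_of_le one_pos x.2).ne'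
  let F : EuclideanSpace ℝ (Fin n) → W := fun x =>
    if h : 1 ≤ ‖x‖ then β ⟨x, h⟩ else a (proj n x)
  have hβs : ∀ (s : UnitSphere n) (t : I) h,
      β ⟨(1 + t : ℝ) • (s : EuclideanSpace ℝ (Fin n)), h⟩ = b (s, t) := fun s t h => by
    have hs : ‖(s : EuclideanSpace ℝ (Fin n))‖ = 1 := mem_sphere_zero_iff_norm.1 s.2
    have ht : (0 : ℝ) < 1 + t := add_pos_of_pos_of_nonneg one_pos t.2.1
    have hn : ‖(1 + t : ℝ) • (s : EuclideanSpace ℝ (Fin n))‖ = 1 + t := by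
      rw [norm_smul, hs, mul_one, Real.norm_of_nonneg ht.le]
    refine congrArg b (Prod.ext (Subtype.ext ?_) ?_)
    · change ‖(1 + t : ℝ) • (s : EuclideanSpace ℝ (Fin n))‖⁻¹ • (1 + t : ℝ) •
        (s : EuclideanSpace ℝ (Fin n)) = s
      rw [hn, smul_smul, inv_mul_cancel₀ ht.ne', one_smul]
    · change Set.projIcc 0 1 zero_le_one (‖(1 + t : ℝ) • (s : EuclideanSpace ℝ (Fin n))‖ - 1) = t
      rw [hn, add_sub_cancel_left, Set.projIcc_val]
  have hFa : ∀ x : EuclideanSpace ℝ (Fin n), ‖x‖ ≤ 1 → F x = a (proj n x) := fun x hx => by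
    by_cases h : 1 ≤ ‖x‖
    · have hx1 : ‖x‖ = 1 := le_antisymm hx h
      obtain ⟨s, hs⟩ : ∃ s : UnitSphere n, x = ((1 + (0 : I) : ℝ)) •
          (s : EuclideanSpace ℝ (Fin n)) := ⟨⟨x, mem_sphere_zero_iff_norm.2 hx1⟩, by simp⟩
      simp only [F, dif_pos h]
      subst hs
      rw [hβs, hab, proj_smul_sphere _ (by simp)]
    · simp only [F, dif_neg h]
  have hF : Continuous F := by
    have h1 : ContinuousOn F {x | ‖x‖ ≤ 1} :=
      (a.continuous.comp (proj n).continuous).continuousOn.congr hFa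
    have h2 : ContinuousOn F {x | 1 ≤ ‖x‖} := by
      rw [continuousOn_iff_continuous_domRestrict]
      refine hβ.congr fun x => ?_
      change _ = F x.1
      simp only [F]
      rw [dif_pos x.2]
    have h3 := h1.union_of_isClosed h2 (isClosed_le continuous_norm continuous_const)
      (isClosed_le continuous_const continuous_norm)
    rw [← continuousOn_univ]
    exact h3.mono fun x _ => le_total ‖x‖ 1
  refine ⟨⟨F, hF⟩, fun x => ?_, fun s t => ?_⟩
  · exact (hFa x (mem_closedBall_zero_iff.1 x.2)).trans (congrArg a (proj_coe x))
  · have hs : ‖(s : EuclideanSpace ℝ (Fin n))‖ = 1 := mem_sphere_zero_iff_norm.1 s.2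
    have ht : (1 : ℝ) ≤ 1 + t := le_add_of_nonneg_right t.2.1
    have h : 1 ≤ ‖(1 + t : ℝ) • (s : EuclideanSpace ℝ (Fin n))‖ := by
      rwa [norm_smul, hs, mul_one, Real.norm_of_nonneg (zero_le_one.trans ht)]
    change F _ = _
    simp only [F]
    rw [dif_pos h, hβs]

end UnitBall

section Compression

variable {Y Z : Type*} [TopologicalSpace Y] [TopologicalSpace Z] {n : ℕ}

/-- The map `f` on the ball is homotopic relative to the sphere to the composite with `k` of an
extension of `g`. -/
def RelCompressible (k : C(Y, Z)) (f : C(UnitBall n, Z)) (g : C(UnitSphere n, Y)) : Prop :=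
  ∃ g' : C(UnitBall n, Y), (∀ s, g' (sphereToBall n s) = g s) ∧
    f.HomotopicRel (k.comp g') (Set.range (sphereToBall n))

/-- HELP for the pair `(B^n, S^{n-1})` follows from the case of constant homotopies on the
sphere. -/
theorem exists_homotopyExtensionLift_ball (k : C(Y, Z))
    (hk : ∀ (f : C(UnitBall n, Z)) (g : C(UnitSphere n, Y)),
      (∀ s, k (g s) = f (sphereToBall n s)) → RelCompressible k f g)
    (f : C(UnitBall n, Z)) (g : C(UnitSphere n, Y)) (h : C(UnitSphere n × I, Z))
    (h0 : ∀ s, h (s, 0) = f (sphereToBall n s)) (h1 : ∀ s, h (s, 1) = k (g s)) :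
    ∃ (g' : C(UnitBall n, Y)) (h' : C(UnitBall n × I, Z)),
      (∀ s, g' (sphereToBall n s) = g s) ∧ (∀ s t, h' (sphereToBall n s, t) = h (s, t)) ∧
      (∀ x, h' (x, 0) = f x) ∧ ∀ x, h' (x, 1) = k (g' x) := by
  obtain ⟨F, hFf, hFh⟩ := UnitBall.exists_extend_collar f h h0
  let f₁ : C(UnitBall n, Z) := ⟨fun x => F ((2 : ℝ) • (x : EuclideanSpace ℝ (Fin n))), by fun_prop⟩
  have hf₁ : ∀ s, k (g s) = f₁ (sphereToBall n s) := fun s => by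
    rw [← h1, ← hFh]
    change _ = F ((2 : ℝ) • (s : EuclideanSpace ℝ (Fin n)))
    norm_num
  obtain ⟨g', hg', ⟨K⟩⟩ := hk f₁ g hf₁
  have hKs : ∀ s t, K (t, sphereToBall n s) = k (g s) := fun s t =>
    (K.eq_fst t ⟨s, rfl⟩).trans (hf₁ s).symm
  let τ : UnitBall n × I → ℝ := fun p => min 1 (2 * (1 - ‖(p.1 : EuclideanSpace ℝ (Fin n))‖))
  have hτ : Continuous τ := by fun_prop
  let h' : C(UnitBall n × I, Z) :=
    ⟨fun p => K (Set.projIcc 0 1 zero_le_one (p.2 * τ p),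
      UnitBall.proj n (((1 + p.2) / 2 + p.2 * τ p : ℝ) • (p.1 : EuclideanSpace ℝ (Fin n)))), by
      refine K.continuous.comp (Continuous.prodMk (continuous_projIcc.comp (by fun_prop))
        ((UnitBall.proj n).continuous.comp (by fun_prop)))⟩
  refine ⟨⟨fun x => g' (UnitBall.proj n ((2 : ℝ) • (x : EuclideanSpace ℝ (Fin n)))), by fun_prop⟩,
    h', fun s => ?_, fun s t => ?_, fun x => ?_, fun x => ?_⟩
  · change g' (UnitBall.proj n ((2 : ℝ) • (s : EuclideanSpace ℝ (Fin n)))) = _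
    rw [UnitBall.proj_smul_sphere _ one_le_two, hg']
  · have hs : ‖(s : EuclideanSpace ℝ (Fin n))‖ = 1 := mem_sphere_zero_iff_norm.1 s.2
    have hτs : τ (sphereToBall n s, t) = 0 := by
      change min 1 (2 * (1 - ‖(s : EuclideanSpace ℝ (Fin n))‖)) = 0
      rw [hs]
      norm_num
    have ht0 : (0 : ℝ) ≤ (1 + t) / 2 := by have := t.2.1; positivity
    have ht : ‖((1 + t) / 2 : ℝ) • (s : EuclideanSpace ℝ (Fin n))‖ ≤ 1 := by
      rw [norm_smul, hs, mul_one, Real.norm_of_nonneg ht0]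
      have := t.2.2
      linarith
    change K (Set.projIcc 0 1 zero_le_one (t * τ (sphereToBall n s, t)), UnitBall.proj n
      (((1 + t) / 2 + t * τ (sphereToBall n s, t) : ℝ) • (s : EuclideanSpace ℝ (Fin n)))) = _
    rw [hτs, mul_zero, add_zero, Set.projIcc_left, UnitBall.proj_of_norm_le ht]
    refine (K.apply_zero _).trans ?_
    change F ((2 : ℝ) • ((1 + t) / 2 : ℝ) • (s : EuclideanSpace ℝ (Fin n))) = _
    rw [smul_smul, mul_div_cancel₀ _ two_ne_zero, hFh]
  · have hx : ‖(x : EuclideanSpace ℝ (Fin n))‖ ≤ 1 := mem_closedBall_zero_iff.1 x.2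
    have hx' : ‖(1 / 2 : ℝ) • (x : EuclideanSpace ℝ (Fin n))‖ ≤ 1 := by
      rw [norm_smul, Real.norm_of_nonneg (by norm_num)]
      linarith
    change K (Set.projIcc 0 1 zero_le_one (((0 : I) : ℝ) * τ (x, 0)), UnitBall.proj n
      (((1 + (0 : I)) / 2 + (0 : I) * τ (x, 0) : ℝ) • (x : EuclideanSpace ℝ (Fin n)))) = _
    rw [Set.Icc.coe_zero, zero_mul, add_zero, add_zero, Set.projIcc_left,
      UnitBall.proj_of_norm_le hx']
    refine (K.apply_zero _).trans ?_
    change F ((2 : ℝ) • (1 / 2 : ℝ) • (x : EuclideanSpace ℝ (Fin n))) = _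
    rw [smul_smul, mul_one_div_cancel two_ne_zero, one_smul, hFf]
  · change K (Set.projIcc 0 1 zero_le_one (((1 : I) : ℝ) * τ (x, 1)), UnitBall.proj n
      (((1 + (1 : I)) / 2 + (1 : I) * τ (x, 1) : ℝ) • (x : EuclideanSpace ℝ (Fin n)))) =
      k (g' (UnitBall.proj n ((2 : ℝ) • (x : EuclideanSpace ℝ (Fin n)))))
    rw [Set.Icc.coe_one, one_mul]
    have hx1 : ‖(x : EuclideanSpace ℝ (Fin n))‖ ≤ 1 := mem_closedBall_zero_iff.1 x.2
    rcases le_total ‖(x : EuclideanSpace ℝ (Fin n))‖ (1 / 2) with hx | hx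
    · have : τ (x, 1) = 1 := min_eq_left (by dsimp only; linarith)
      rw [this, Set.projIcc_right]
      refine (K.apply_one _).trans ?_
      norm_num
    · have hτx : τ (x, 1) = 2 * (1 - ‖(x : EuclideanSpace ℝ (Fin n))‖) :=
        min_eq_right (by dsimp only; linarith)
      obtain ⟨s, hs⟩ := UnitBall.exists_eq_norm_smul
        (norm_pos_iff.1 (lt_of_lt_of_le (by norm_num) hx))
      rw [hτx]
      generalize ‖(x : EuclideanSpace ℝ (Fin n))‖ = r at *
      rw [hs, smul_smul, smul_smul, UnitBall.proj_smul_sphere _ (by nlinarith),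
        UnitBall.proj_smul_sphere _ (by linarith), hKs, hg']

/-- Compressibility is invariant under homotopies of the map on the sphere. -/
theorem RelCompressible.of_homotopy (k : C(Y, Z)) (γ : C(UnitSphere n × I, Y))
    (h : ∀ f : C(UnitBall n, Z), (∀ s, k (γ (s, 1)) = f (sphereToBall n s)) →
      RelCompressible k f ⟨fun s => γ (s, 1), by fun_prop⟩)
    (f : C(UnitBall n, Z)) (hf : ∀ s, k (γ (s, 0)) = f (sphereToBall n s)) :
    RelCompressible k f ⟨fun s => γ (s, 0), by fun_prop⟩ := by
  obtain ⟨F, hFf, hFγ⟩ := UnitBall.exists_extend_collar f (k.comp γ) hf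
  let f₂ : C(UnitBall n, Z) := ⟨fun x => F ((2 : ℝ) • (x : EuclideanSpace ℝ (Fin n))), by fun_prop⟩
  have hf₂ : ∀ s, k (γ (s, 1)) = f₂ (sphereToBall n s) := fun s => by
    refine (hFγ s 1).symm.trans ?_
    change _ = F ((2 : ℝ) • (s : EuclideanSpace ℝ (Fin n)))
    norm_num
  obtain ⟨G, hG, ⟨K⟩⟩ := h f₂ hf₂
  have hKs : ∀ s t, K (t, sphereToBall n s) = k (γ (s, 1)) := fun s t =>
    (K.eq_fst t ⟨s, rfl⟩).trans (hf₂ s).symm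
  let γr : C(UnitSphere n × I, Y) := ⟨fun p => γ (p.1, unitInterval.symm p.2), by fun_prop⟩
  obtain ⟨G', hG'G, hG'γ⟩ := UnitBall.exists_extend_collar G γr
    (fun s => by simp [γr, hG])
  -- the homotopy `K`, extended by the constant homotopy on the collar
  obtain ⟨L, hLK, hLγ⟩ := UnitBall.exists_extend_collar (W := C(I, Z))
    (ContinuousMap.curry ⟨fun p : UnitBall n × I => K (p.2, p.1), by fun_prop⟩)
    (ContinuousMap.curry ⟨fun p : (UnitSphere n × I) × I => k (γr p.1), by fun_prop⟩)
    (fun s => by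
      ext t
      simp [γr, hKs])
  let ρ : UnitBall n → ℝ := fun x => min 4 ((3 - 2 * ‖(x : EuclideanSpace ℝ (Fin n))‖) *
    (max (1 / 4) ‖(x : EuclideanSpace ℝ (Fin n))‖)⁻¹)
  have hρ : Continuous ρ := by
    refine continuous_const.min (Continuous.mul (by fun_prop) (Continuous.inv₀ (by fun_prop) ?_))
    exact fun x => (lt_of_lt_of_le (by norm_num) (le_max_left _ _)).ne'
  have hρ1 : ∀ x : UnitBall n, ‖(x : EuclideanSpace ℝ (Fin n))‖ ≤ 1 / 2 → ρ x = 4 := fun x hx => by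
    refine min_eq_left ?_
    have h4 : (0 : ℝ) < max (1 / 4) ‖(x : EuclideanSpace ℝ (Fin n))‖ :=
      lt_of_lt_of_le (by norm_num) (le_max_left _ _)
    rw [← div_eq_mul_inv, le_div_iff₀ h4]
    rcases max_cases (1 / 4) ‖(x : EuclideanSpace ℝ (Fin n))‖ with h | h <;> linarith
  have hρ2 : ∀ x : UnitBall n, 1 / 2 ≤ ‖(x : EuclideanSpace ℝ (Fin n))‖ →
      ρ x * ‖(x : EuclideanSpace ℝ (Fin n))‖ = 3 - 2 * ‖(x : EuclideanSpace ℝ (Fin n))‖ :=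
    fun x hx => by
    have h0 : 0 < ‖(x : EuclideanSpace ℝ (Fin n))‖ := by linarith
    have : ρ x = (3 - 2 * ‖(x : EuclideanSpace ℝ (Fin n))‖) *
        ‖(x : EuclideanSpace ℝ (Fin n))‖⁻¹ := by
      simp only [ρ]
      rw [max_eq_right (by linarith), min_eq_right]
      rw [← div_eq_mul_inv, div_le_iff₀ h0]
      linarith
    rw [this, mul_assoc, inv_mul_cancel₀ h0.ne', mul_one]
  let f' : C(UnitBall n, Z) := ⟨fun x => F (ρ x • (x : EuclideanSpace ℝ (Fin n))), by fun_prop⟩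
  have hr : ∀ s : UnitSphere n, ρ (sphereToBall n s) = 1 := fun s => by
    have hs : ‖(sphereToBall n s : EuclideanSpace ℝ (Fin n))‖ = 1 :=
      mem_sphere_zero_iff_norm.1 s.2
    have := hρ2 (sphereToBall n s) (by rw [hs]; norm_num)
    rw [hs] at this
    linarith
  have hff' : f.HomotopicRel f' (Set.range (sphereToBall n)) :=
    ⟨{ toFun := fun p => F ((1 + p.1 * (ρ p.2 - 1) : ℝ) • (p.2 : EuclideanSpace ℝ (Fin n)))
       continuous_toFun := by fun_prop
       map_zero_left := fun x => by simp [hFf]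
       map_one_left := fun x => by simp [f']
       prop' := by
        rintro t _ ⟨s, rfl⟩
        simp [hr, hFf] }⟩
  let g' : C(UnitBall n, Y) :=
    ⟨fun x => G' ((2 : ℝ) • (x : EuclideanSpace ℝ (Fin n))), by fun_prop⟩
  have hcases : ∀ x : UnitBall n, (∃ y : UnitBall n, ρ x • (x : EuclideanSpace ℝ (Fin n)) =
        (2 : ℝ) • (y : EuclideanSpace ℝ (Fin n)) ∧ (2 : ℝ) • (x : EuclideanSpace ℝ (Fin n)) = y) ∨
      ∃ (s : UnitSphere n) (t : I), ρ x • (x : EuclideanSpace ℝ (Fin n)) =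
        (1 + unitInterval.symm t : ℝ) • (s : EuclideanSpace ℝ (Fin n)) ∧
        (2 : ℝ) • (x : EuclideanSpace ℝ (Fin n)) =
        (1 + t : ℝ) • (s : EuclideanSpace ℝ (Fin n)) := fun x => by
    have hx1 : ‖(x : EuclideanSpace ℝ (Fin n))‖ ≤ 1 := mem_closedBall_zero_iff.1 x.2
    rcases le_total ‖(x : EuclideanSpace ℝ (Fin n))‖ (1 / 2) with hx | hx
    · refine Or.inl ⟨⟨(2 : ℝ) • (x : EuclideanSpace ℝ (Fin n)), ?_⟩, ?_, rfl⟩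
      · rw [mem_closedBall_zero_iff, norm_smul, Real.norm_of_nonneg zero_le_two]
        linarith
      · rw [hρ1 x hx, smul_smul]
        norm_num
    · obtain ⟨s, hs⟩ := UnitBall.exists_eq_norm_smul
        (norm_pos_iff.1 (lt_of_lt_of_le (by norm_num) hx))
      refine Or.inr ⟨s, ⟨2 * ‖(x : EuclideanSpace ℝ (Fin n))‖ - 1, by linarith, by linarith⟩, ?_, ?_⟩
      · refine (congrArg (ρ x • ·) hs).trans ?_
        rw [smul_smul, hρ2 x hx, unitInterval.coe_symm_eq]
        congr 1
        ring
      · refine (congrArg ((2 : ℝ) • ·) hs).trans ?_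
        rw [smul_smul]
        congr 1
        ring
  have hf'g' : f'.HomotopicRel (k.comp g') (Set.range (sphereToBall n)) := by
    have hL0 : ∀ x : UnitBall n, L ((2 : ℝ) • (x : EuclideanSpace ℝ (Fin n))) 0 = f' x := fun x => by
      change _ = F _
      rcases hcases x with ⟨y, h1, h2⟩ | ⟨s, t, h1, h2⟩
      · rw [h1, h2, hLK]
        exact K.apply_zero y
      · rw [h1, h2, hLγ, hFγ]
        rfl
    refine ⟨{ toFun := fun p => L ((2 : ℝ) • (p.2 : EuclideanSpace ℝ (Fin n))) p.1
              continuous_toFun := by fun_prop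
              map_zero_left := hL0
              map_one_left := fun x => ?_
              prop' := ?_ }⟩
    · change _ = k (G' _)
      rcases hcases x with ⟨y, h1, h2⟩ | ⟨s, t, h1, h2⟩
      · rw [h2, hLK, hG'G]
        exact K.apply_one y
      · rw [h2, hLγ, hG'γ]
        rfl
    · rintro t _ ⟨s, rfl⟩
      refine Eq.trans ?_ (hL0 (sphereToBall n s))
      have h2 : (2 : ℝ) • (sphereToBall n s : EuclideanSpace ℝ (Fin n)) =
          (1 + (1 : I) : ℝ) • (s : EuclideanSpace ℝ (Fin n)) := by
        rw [Set.Icc.coe_one, one_add_one_eq_two]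
        rfl
      change L ((2 : ℝ) • (sphereToBall n s : EuclideanSpace ℝ (Fin n))) t = _
      rw [h2, hLγ]
      rfl
  refine ⟨g', fun s => ?_, hff'.trans hf'g'⟩
  have h2 : (2 : ℝ) • (sphereToBall n s : EuclideanSpace ℝ (Fin n)) =
      (1 + (1 : I) : ℝ) • (s : EuclideanSpace ℝ (Fin n)) := by
    rw [Set.Icc.coe_one, one_add_one_eq_two]
    rfl
  change G' _ = _
  rw [h2, hG'γ]
  simp [γr]

/-- To show compressibility, one may assume that the map on the sphere is constant on a given
proper closed subset. -/
theorem RelCompressible.of_forall_constant_on (k : C(Y, Z)) (J : Set (UnitSphere n))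
    (hJ : IsClosed J) (v : UnitSphere n) (hv : v ∉ J)
    (h : ∀ (f : C(UnitBall n, Z)) (g : C(UnitSphere n, Y)) (y : Y),
      (∀ s, k (g s) = f (sphereToBall n s)) → (∀ s ∈ J, g s = y) → RelCompressible k f g)
    (f : C(UnitBall n, Z)) (g : C(UnitSphere n, Y)) (hf : ∀ s, k (g s) = f (sphereToBall n s)) :
    RelCompressible k f g := by
  obtain ⟨c, hcv, hcJ, hc⟩ := exists_continuous_zero_one_of_isClosed (isClosed_singleton (x := v))
    hJ (Set.disjoint_singleton_left.2 hv)
  have hv1 : ‖(v : EuclideanSpace ℝ (Fin n))‖ = 1 := mem_sphere_zero_iff_norm.1 v.2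
  let φ : UnitSphere n × I → EuclideanSpace ℝ (Fin n) := fun p =>
    (1 - p.2 * c p.1 : ℝ) • (p.1 : EuclideanSpace ℝ (Fin n)) -
      (p.2 * c p.1 : ℝ) • (v : EuclideanSpace ℝ (Fin n))
  have hφ : Continuous φ := by fun_prop
  have hφ0 : ∀ p, φ p ≠ 0 := by
    rintro ⟨s, t⟩ hst
    have hs1 : ‖(s : EuclideanSpace ℝ (Fin n))‖ = 1 := mem_sphere_zero_iff_norm.1 s.2
    have hl0 : (0 : ℝ) ≤ t * c s := mul_nonneg t.2.1 (hc s).1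
    have hl1 : (t * c s : ℝ) ≤ 1 := mul_le_one₀ t.2.2 (hc s).1 (hc s).2
    have heq : (1 - t * c s : ℝ) • (s : EuclideanSpace ℝ (Fin n)) =
        (t * c s : ℝ) • (v : EuclideanSpace ℝ (Fin n)) := sub_eq_zero.1 hst
    have hn := congrArg norm heq
    rw [norm_smul, norm_smul, hs1, hv1, Real.norm_of_nonneg hl0,
      Real.norm_of_nonneg (sub_nonneg.2 hl1), mul_one, mul_one] at hn
    have hl : (t * c s : ℝ) = 1 / 2 := by linarith
    rw [hl] at heq
    have hsv : s = v := by
      refine Subtype.ext (smul_right_injective _ (r := (1 / 2 : ℝ)) (by norm_num) ?_)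
      change (1 / 2 : ℝ) • _ = (1 / 2 : ℝ) • _
      rw [← heq]
      norm_num
    rw [hsv, hcv rfl] at hl
    norm_num at hl
  have hψ : Continuous fun p => ‖φ p‖⁻¹ • φ p :=
    (hφ.norm.inv₀ fun p => norm_ne_zero_iff.2 (hφ0 p)).smul hφ
  have hψ1 : ∀ p, ‖φ p‖⁻¹ • φ p ∈ Metric.sphere (0 : EuclideanSpace ℝ (Fin n)) 1 := fun p => by
    rw [mem_sphere_zero_iff_norm, norm_smul, norm_inv, norm_norm,
      inv_mul_cancel₀ (norm_ne_zero_iff.2 (hφ0 p))]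
  let Φ : C(UnitSphere n × I, UnitSphere n) := ⟨fun p => ⟨‖φ p‖⁻¹ • φ p, hψ1 p⟩, hψ.subtype_mk hψ1⟩
  have hΦ0 : ∀ s, Φ (s, 0) = s := fun s => by
    have hs1 : ‖(s : EuclideanSpace ℝ (Fin n))‖ = 1 := mem_sphere_zero_iff_norm.1 s.2
    refine Subtype.ext ?_
    change ‖φ (s, 0)‖⁻¹ • φ (s, 0) = s
    have : φ (s, 0) = s := by simp [φ]
    rw [this, hs1, inv_one, one_smul]
  have hΦ1 : ∀ s ∈ J, Φ (s, 1) = -v := fun s hs => by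
    refine Subtype.ext ?_
    change ‖φ (s, 1)‖⁻¹ • φ (s, 1) = -v
    have hcs : c s = 1 := hcJ hs
    have : φ (s, 1) = -v := by simp [φ, hcs]
    rw [this, norm_neg, hv1, inv_one, one_smul]
  have := RelCompressible.of_homotopy k (g.comp Φ)
    (fun f hf => h f _ (g (-v)) hf fun s hs => congrArg g (hΦ1 s hs)) f
    (fun s => by simp [hΦ0, hf])
  convert this using 1
  ext s
  simp [hΦ0]

end Compression

namespace GenLoop

variable {N T W : Type*} [TopologicalSpace T] [TopologicalSpace W] {z : W}

/-- The family of generalized loops given by a map on the product of the parameter space and the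
cube. -/
def ofFamily (F : C(T × (N → I), W)) (hF : ∀ t, ∀ x ∈ Cube.boundary N, F (t, x) = z) :
    C(T, GenLoop N W z) :=
  ⟨fun t => ⟨F.curry t, hF t⟩, F.curry.continuous.subtype_mk _⟩

theorem homotopic_iff_joined {p p' : GenLoop N W z} : Homotopic p p' ↔ Joined p p' := by
  constructor
  · rintro ⟨H⟩
    have hH : ∀ t, ∀ x ∈ Cube.boundary N, H (t, x) = z := fun t x hx =>
      (H.eq_fst t hx).trans (p.2 x hx)
    exact ⟨⟨ofFamily H.toContinuousMap hH, Subtype.ext (ContinuousMap.ext H.apply_zero),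
      Subtype.ext (ContinuousMap.ext H.apply_one)⟩⟩
  · rintro ⟨γ⟩
    exact ⟨{ toFun := fun x => γ x.1 x.2
             continuous_toFun := by fun_prop
             map_zero_left := fun x => by simp
             map_one_left := fun x => by simp
             prop' := fun t x hx => ((γ t).2 x hx).trans (p.2 x hx).symm }⟩

variable {Y Z : Type*} [TopologicalSpace Y] [TopologicalSpace Z]

/-- The map on spaces of generalized loops induced by a continuous map. -/
def map (N : Type*) (k : C(Y, Z)) (y : Y) : C(GenLoop N Y y, GenLoop N Z (k y)) :=
  ⟨fun p => ⟨k.comp p.1, fun x hx => congrArg k (p.2 x hx)⟩,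
    (k.continuous_postcomp.comp continuous_subtype_val).subtype_mk _⟩

end GenLoop

theorem Fin.mem_cubeBoundary_iff {m : ℕ} {x : Fin (m + 1) → I} :
    x ∈ Cube.boundary (Fin (m + 1)) ↔
      (x 0 = 0 ∨ x 0 = 1) ∨ Fin.tail x ∈ Cube.boundary (Fin m) :=
  Fin.exists_fin_succ

theorem Fin.cons_mem_cubeBoundary {m : ℕ} (t : I) {x : Fin m → I}
    (hx : x ∈ Cube.boundary (Fin m)) :
    (Fin.cons t x : Fin (m + 1) → I) ∈ Cube.boundary (Fin (m + 1)) :=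
  Fin.mem_cubeBoundary_iff.2 (Or.inr (by rwa [Fin.tail_cons]))

/-- If `κ` is injective on path components and surjective on the fundamental group at `b`, then
every path between points in the image of `κ` lifts up to homotopy. -/
theorem Path.exists_map_homotopic {P Q : Type*} [TopologicalSpace P] [TopologicalSpace Q]
    (κ : C(P, Q)) {a b : P} (h0 : Joined (κ b) (κ a) → Joined b a)
    (h1 : ∀ l : Path (κ b) (κ b), ∃ l' : Path b b, (l'.map κ.continuous).Homotopic l)
    (f : Path (κ b) (κ a)) : ∃ f' : Path b a, (f'.map κ.continuous).Homotopic f := by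
  obtain ⟨e⟩ := h0 ⟨f⟩
  obtain ⟨l, hl⟩ := h1 (f.trans (e.map κ.continuous).symm)
  refine ⟨l.trans e, ?_⟩
  rw [Path.map_trans]
  refine (hl.hcomp (Path.Homotopic.refl _)).trans ?_
  refine Path.Homotopic.trans ⟨Path.Homotopy.transAssoc _ _ _⟩ ?_
  refine ((Path.Homotopic.refl f).hcomp ⟨(Path.Homotopy.reflSymmTrans _).symm⟩).trans ?_
  exact ⟨Path.Homotopy.transRefl f⟩

namespace IsNEquivalence

variable {Y Z : Type*} [TopologicalSpace Y] [TopologicalSpace Z] {n : ℕ∞} {k : C(Y, Z)}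

theorem joined_genLoop (hk : IsNEquivalence n k) {m : ℕ} (hm : (m : ℕ∞) < n) (y : Y)
    (p p' : GenLoop (Fin m) Y y)
    (h : Joined (GenLoop.map (Fin m) k y p) (GenLoop.map (Fin m) k y p')) : Joined p p' := by
  rcases Nat.eq_zero_or_pos m with rfl | hm0
  · have hinj := (hk.bijective_zero (by simpa using hm)).injective
    have hj : Joined (k (p default)) (k (p' default)) :=
      h.map (f := fun q : GenLoop (Fin 0) Z (k y) => q default) (by fun_prop)
    have hq : (⟦p default⟧ : ZerothHomotopy Y) = ⟦p' default⟧ := hinj (Quotient.sound hj)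
    obtain ⟨γ⟩ : Joined (p default) (p' default) := Quotient.exact hq
    refine ⟨⟨GenLoop.ofFamily ⟨fun x => γ x.1, by fun_prop⟩ fun t x hx => hx.choose.elim0,
      ?_, ?_⟩⟩
    · ext x
      rw [Subsingleton.elim x default]
      exact γ.source
    · ext x
      rw [Subsingleton.elim x default]
      exact γ.target
  · rw [← GenLoop.homotopic_iff_joined] at h ⊢
    have hq : (⟦p⟧ : HomotopyGroup.Pi m Y y) = ⟦p'⟧ :=
      (hk.bijective m hm0 hm y).injective (Quotient.sound h)
    exact Quotient.exact hq

theorem exists_map_genLoop_homotopic (hk : IsNEquivalence n k) {q : ℕ} (hq : 1 ≤ q)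
    (hqn : (q : ℕ∞) ≤ n) (y : Y) (p : GenLoop (Fin q) Z (k y)) :
    ∃ p' : GenLoop (Fin q) Y y, GenLoop.Homotopic (GenLoop.map (Fin q) k y p') p := by
  have hs : Function.Surjective (piMap q k y) := by
    rcases hqn.lt_or_eq with h | h
    · exact (hk.bijective q hq h y).surjective
    · exact hk.surjective q hq h y
  obtain ⟨p', hp'⟩ := hs ⟦p⟧
  induction p' using Quotient.inductionOn with
  | h p' => exact ⟨p', Quotient.exact hp'⟩

theorem exists_map_loop_homotopic (hk : IsNEquivalence n k) {m : ℕ} (hm : ((m + 1 : ℕ) : ℕ∞) ≤ n)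
    (y : Y) (l : Path (GenLoop.map (Fin m) k y GenLoop.const)
      (GenLoop.map (Fin m) k y GenLoop.const)) :
    ∃ l' : Path (GenLoop.const : GenLoop (Fin m) Y y) GenLoop.const,
      (l'.map (GenLoop.map (Fin m) k y).continuous).Homotopic l := by
  let p : GenLoop (Fin (m + 1)) Z (k y) :=
    ⟨⟨fun x => l (x 0) (Fin.tail x), by unfold Fin.tail; fun_prop⟩, fun x hx => by
      rcases Fin.mem_cubeBoundary_iff.1 hx with (h | h) | h
      · change l (x 0) (Fin.tail x) = k y
        rw [h, l.source]
        rfl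
      · change l (x 0) (Fin.tail x) = k y
        rw [h, l.target]
        rfl
      · exact (l (x 0)).2 _ h⟩
  obtain ⟨p', ⟨H⟩⟩ := hk.exists_map_genLoop_homotopic (Nat.le_add_left 1 m) hm y p
  have hp : ∀ t x, p (Fin.cons t x : Fin (m + 1) → I) = l t x := fun t x => by
    change l ((Fin.cons t x : Fin (m + 1) → I) 0) (Fin.tail (Fin.cons t x : Fin (m + 1) → I)) = _
    rw [Fin.cons_zero, Fin.tail_cons]
  have hb0 : ∀ x : Fin m → I,
      (Fin.cons 0 x : Fin (m + 1) → I) ∈ Cube.boundary (Fin (m + 1)) := fun x => ⟨0, Or.inl rfl⟩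
  have hb1 : ∀ x : Fin m → I,
      (Fin.cons 1 x : Fin (m + 1) → I) ∈ Cube.boundary (Fin (m + 1)) := fun x => ⟨0, Or.inr rfl⟩
  let l' : Path (GenLoop.const : GenLoop (Fin m) Y y) GenLoop.const :=
    ⟨GenLoop.ofFamily ⟨fun x => p' (Fin.cons x.1 x.2 : Fin (m + 1) → I), by fun_prop⟩
        fun t x hx => p'.2 _ (Fin.cons_mem_cubeBoundary t hx),
      GenLoop.ext _ _ fun x => p'.2 _ (hb0 x), GenLoop.ext _ _ fun x => p'.2 _ (hb1 x)⟩
  have hH : ∀ s, ∀ x ∈ Cube.boundary (Fin (m + 1)), H (s, x) = k y := fun s x hx =>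
    (H.eq_fst s hx).trans (congrArg k (p'.2 x hx))
  refine ⟨l', ⟨⟨⟨GenLoop.ofFamily
    ⟨fun x : (I × I) × (Fin m → I) => H (x.1.1, (Fin.cons x.1.2 x.2 : Fin (m + 1) → I)),
      by fun_prop⟩
    fun t x hx => hH _ _ (Fin.cons_mem_cubeBoundary t.2 hx), fun t => ?_, fun t => ?_⟩, ?_⟩⟩⟩
  · exact GenLoop.ext _ _ fun x => H.apply_zero _
  · exact GenLoop.ext _ _ fun x => (H.apply_one _).trans (hp t x)
  · rintro s t (rfl | rfl)
    · exact GenLoop.ext _ _ fun x => (hH _ _ (hb0 x)).trans (congrArg k (p'.2 _ (hb0 x))).symm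
    · exact GenLoop.ext _ _ fun x => (hH _ _ (hb1 x)).trans (congrArg k (p'.2 _ (hb1 x))).symm

/-- Compression on the cube, for a map on its boundary that is constant outside the interior of
the face `x 0 = 1`. -/
theorem exists_compression_cube (hk : IsNEquivalence n k) {m : ℕ}
    (hm : ((m + 1 : ℕ) : ℕ∞) ≤ n) (f : C(Fin (m + 1) → I, Z))
    (g : C(Cube.boundary (Fin (m + 1)), Y)) (hfg : ∀ x, k (g x) = f x) (y : Y)
    (hy : ∀ x, x.1 0 = 0 ∨ (Fin.tail x.1 : Fin m → I) ∈ Cube.boundary (Fin m) → g x = y) :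
    ∃ G : C(Fin (m + 1) → I, Y), (∀ x : Cube.boundary (Fin (m + 1)), G x = g x) ∧
      f.HomotopicRel (k.comp G) (Cube.boundary (Fin (m + 1))) := by
  have hb1 : ∀ x : Fin m → I,
      (Fin.cons 1 x : Fin (m + 1) → I) ∈ Cube.boundary (Fin (m + 1)) := fun x => ⟨0, Or.inr rfl⟩
  let a : GenLoop (Fin m) Y y :=
    ⟨⟨fun x => g ⟨Fin.cons 1 x, hb1 x⟩, g.continuous.comp (Continuous.subtype_mk (by fun_prop) _)⟩,
      fun x hx => hy ⟨Fin.cons 1 x, hb1 x⟩ (Or.inr (by rwa [Fin.tail_cons]))⟩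
  have hfJ : ∀ x : Fin (m + 1) → I, x 0 = 0 ∨ Fin.tail x ∈ Cube.boundary (Fin m) → f x = k y :=
    fun x hx => by
      have hxb : x ∈ Cube.boundary (Fin (m + 1)) :=
        Fin.mem_cubeBoundary_iff.2 (hx.imp Or.inl id)
      rw [← hy ⟨x, hxb⟩ hx, hfg]
  let l : Path (GenLoop.map (Fin m) k y GenLoop.const) (GenLoop.map (Fin m) k y a) :=
    ⟨GenLoop.ofFamily ⟨fun x => f (Fin.cons x.1 x.2 : Fin (m + 1) → I), by fun_prop⟩
      fun t x hx => hfJ _ (Or.inr (by rwa [Fin.tail_cons])),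
      GenLoop.ext _ _ fun x => hfJ _ (Or.inl (Fin.cons_zero _ _)),
      GenLoop.ext _ _ fun x => (hfg ⟨Fin.cons 1 x, hb1 x⟩).symm⟩
  have hmn : (m : ℕ∞) < n := lt_of_lt_of_le (by exact_mod_cast m.lt_succ_self) hm
  obtain ⟨γ, ⟨H⟩⟩ := Path.exists_map_homotopic (GenLoop.map (Fin m) k y)
    (hk.joined_genLoop hmn y _ _) (hk.exists_map_loop_homotopic hm y) l
  let G : C(Fin (m + 1) → I, Y) := ⟨fun x => γ (x 0) (Fin.tail x), by unfold Fin.tail; fun_prop⟩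
  have hG : ∀ x : Cube.boundary (Fin (m + 1)), G x = g x := fun x => by
    change γ (x.1 0) (Fin.tail x.1) = g x
    rcases Fin.mem_cubeBoundary_iff.1 x.2 with (h | h) | h
    · rw [h, γ.source, hy x (Or.inl h)]
      rfl
    · rw [h, γ.target]
      refine congrArg g (Subtype.ext ?_)
      change (Fin.cons 1 (Fin.tail x.1) : Fin (m + 1) → I) = x.1
      rw [← h, Fin.cons_self_tail]
    · rw [hy x (Or.inr h)]
      exact (γ _).2 _ h
  have hl : ∀ x : Fin (m + 1) → I, l (x 0) (Fin.tail x) = f x := fun x => by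
    change f (Fin.cons (x 0) (Fin.tail x) : Fin (m + 1) → I) = f x
    rw [Fin.cons_self_tail]
  refine ⟨G, hG, ContinuousMap.HomotopicRel.symm ⟨{
    toFun := fun x => H (x.1, x.2 0) (Fin.tail x.2)
    continuous_toFun := by unfold Fin.tail; fun_prop
    map_zero_left := fun x => by
      rw [H.apply_zero]
      rfl
    map_one_left := fun x => by
      rw [H.apply_one]
      exact hl x
    prop' := fun s x hx => ?_ }⟩⟩
  change H (s, x 0) (Fin.tail x) = k (G x)
  rw [hG ⟨x, hx⟩]
  rcases Fin.mem_cubeBoundary_iff.1 hx with (h | h) | h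
  · rw [h, Path.Homotopy.source, hy ⟨x, hx⟩ (Or.inl h)]
    rfl
  · rw [h, Path.Homotopy.target]
    refine Eq.trans ?_ ((hl x).trans (hfg ⟨x, hx⟩).symm)
    rw [h, l.target]
  · rw [hy ⟨x, hx⟩ (Or.inr h)]
    exact (H _).2 _ h

end IsNEquivalence

theorem Cube.isClosed_boundary (N : Type*) [Finite N] : IsClosed (Cube.boundary N) := by
  have : Cube.boundary N = ⋃ i, {x : N → I | x i = 0 ∨ x i = 1} := by
    ext x
    simp [Cube.boundary]
  rw [this]
  exact isClosed_iUnion_of_finite fun i =>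
    (isClosed_eq (continuous_apply i) continuous_const).union
      (isClosed_eq (continuous_apply i) continuous_const)

/-- The cube is homeomorphic to the ball by a homeomorphism that identifies the boundaries. -/
theorem Cube.exists_homeomorph_unitBall (n : ℕ) :
    ∃ e : (Fin n → I) ≃ₜ UnitBall n, ∀ x,
      x ∈ Cube.boundary (Fin n) ↔ e x ∈ Set.range (sphereToBall n) := by
  let φ : EuclideanSpace ℝ (Fin n) ≃ₜ (Fin n → ℝ) := (EuclideanSpace.equiv (Fin n) ℝ).toHomeomorph
  let s : Set (EuclideanSpace ℝ (Fin n)) := φ ⁻¹' Set.univ.pi fun _ => Set.Icc 0 1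
  have hsc : IsClosed s := (isClosed_set_pi fun _ _ => isClosed_Icc).preimage φ.continuous
  have hsi : interior s = φ ⁻¹' Set.univ.pi fun _ => Set.Ioo 0 1 := by
    rw [← φ.preimage_interior, interior_pi_set Set.finite_univ]
    simp
  have hconv : Convex ℝ s := (convex_pi fun _ _ => convex_Icc 0 1).linear_preimage
    (EuclideanSpace.equiv (Fin n) ℝ).toLinearEquiv.toLinearMap
  have hcpt : IsCompact s :=
    φ.isCompact_preimage.2 (isCompact_univ_pi fun _ => isCompact_Icc)
  have hne : (interior s).Nonempty := by
    rw [hsi]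
    refine ⟨φ.symm fun _ => 1 / 2, ?_⟩
    simp only [Set.mem_preimage, Homeomorph.apply_symm_apply]
    exact fun _ _ => ⟨by norm_num, by norm_num⟩
  obtain ⟨h, -, hc, hf⟩ := exists_homeomorph_image_interior_closure_frontier_eq_unitBall hconv hne
    hcpt.isBounded
  rw [hsc.closure_eq] at hc
  rw [hsc.frontier_eq] at hf
  let ι : (Fin n → I) → EuclideanSpace ℝ (Fin n) := fun x => φ.symm fun i => x i
  have hιs : ∀ x, ι x ∈ s := fun x => by
    simp only [s, ι, Set.mem_preimage, Homeomorph.apply_symm_apply]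
    exact fun i _ => (x i).2
  have hιc : Continuous ι := φ.symm.continuous.comp (by fun_prop)
  have hmem : ∀ x, h (ι x) ∈ Metric.closedBall (0 : EuclideanSpace ℝ (Fin n)) 1 := fun x =>
    hc ▸ Set.mem_image_of_mem h (hιs x)
  let ε : (Fin n → I) → UnitBall n := fun x => ⟨h (ι x), hmem x⟩
  have hεc : Continuous ε := (h.continuous.comp hιc).subtype_mk _
  have hε : Function.Bijective ε := by
    constructor
    · intro x x' hxx'
      have h1 := φ.symm.injective (h.injective (congrArg Subtype.val hxx'))
      ext i
      exact congrFun h1 i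
    · rintro ⟨b, hb⟩
      rw [← hc] at hb
      obtain ⟨a, ha, rfl⟩ := hb
      refine ⟨fun i => ⟨φ a i, ha i trivial⟩, Subtype.ext (congrArg h ?_)⟩
      exact φ.symm_apply_apply a
  refine ⟨Continuous.homeoOfEquivCompactToT2 (f := Equiv.ofBijective ε hε) hεc, fun x => ?_⟩
  have hint : ι x ∈ interior s ↔ x ∉ Cube.boundary (Fin n) := by
    rw [hsi]
    simp only [ι, Set.mem_preimage, Homeomorph.apply_symm_apply, Set.mem_univ_pi, Cube.boundary,
      Set.mem_ofPred_eq, not_exists, not_or]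
    refine forall_congr' fun i => ?_
    rw [Set.mem_Ioo, unitInterval.coe_pos, unitInterval.coe_lt_one, unitInterval.pos_iff_ne_zero,
      unitInterval.lt_one_iff_ne_one]
  have hsph : h (ι x) ∈ Metric.sphere (0 : EuclideanSpace ℝ (Fin n)) 1 ↔
      x ∈ Cube.boundary (Fin n) := by
    rw [← hf, h.injective.mem_set_image, Set.mem_sdiff, hint, not_not]
    exact and_iff_right (hιs x)
  rw [← hsph]
  constructor
  · exact fun hx => ⟨⟨_, hx⟩, rfl⟩
  · rintro ⟨b, hb⟩
    have := congrArg Subtype.val hb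
    change (b : EuclideanSpace ℝ (Fin n)) = h (ι x) at this
    exact this ▸ b.2

theorem IsNEquivalence.relCompressible {Y Z : Type*} [TopologicalSpace Y] [TopologicalSpace Z]
    {n : ℕ∞} {k : C(Y, Z)} (hk : IsNEquivalence n k) {m : ℕ} (hm : ((m + 1 : ℕ) : ℕ∞) ≤ n)
    (f : C(UnitBall (m + 1), Z)) (g : C(UnitSphere (m + 1), Y))
    (hf : ∀ s, k (g s) = f (sphereToBall (m + 1) s)) : RelCompressible k f g := by
  obtain ⟨e, he⟩ := Cube.exists_homeomorph_unitBall (m + 1)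
  have hιc : Continuous (sphereToBall (m + 1)) := continuous_inclusion Metric.sphere_subset_closedBall
  let J : Set (UnitSphere (m + 1)) := {s | e.symm (sphereToBall (m + 1) s) 0 = 0 ∨
    Fin.tail (e.symm (sphereToBall (m + 1) s)) ∈ Cube.boundary (Fin m)}
  have hJ : IsClosed J := by
    have hc : Continuous fun s => e.symm (sphereToBall (m + 1) s) := e.symm.continuous.comp hιc
    refine IsClosed.union (isClosed_eq ((continuous_apply 0).comp hc) continuous_const)
      ((Cube.isClosed_boundary (Fin m)).preimage ?_)
    unfold Fin.tail
    fun_prop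
  let c : Fin (m + 1) → I := Fin.cons 1 fun _ => ⟨1 / 2, by norm_num, by norm_num⟩
  obtain ⟨v, hv⟩ := (he c).1 ⟨0, Or.inr rfl⟩
  refine RelCompressible.of_forall_constant_on k J hJ v ?_ ?_ f g hf
  · change ¬ (e.symm (sphereToBall (m + 1) v) 0 = 0 ∨
      Fin.tail (e.symm (sphereToBall (m + 1) v)) ∈ Cube.boundary (Fin m))
    rw [hv, e.symm_apply_apply]
    rintro (h | ⟨i, h | h⟩)
    · exact one_ne_zero h
    · have := congrArg Subtype.val h
      norm_num [c, Fin.tail] at this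
    · have := congrArg Subtype.val h
      norm_num [c, Fin.tail] at this
  · intro f g y hf hy
    have hr : ∀ x : Cube.boundary (Fin (m + 1)),
        (e x : EuclideanSpace ℝ (Fin (m + 1))) ∈ Metric.sphere 0 1 := fun x => by
      obtain ⟨s, hs⟩ := (he x).1 x.2
      exact hs ▸ s.2
    let r : C(Cube.boundary (Fin (m + 1)), UnitSphere (m + 1)) :=
      ⟨fun x => ⟨e x, hr x⟩, Continuous.subtype_mk (by fun_prop) _⟩
    have hre : ∀ x, sphereToBall (m + 1) (r x) = e x := fun x => rfl
    obtain ⟨G, hG, ⟨H⟩⟩ := hk.exists_compression_cube hm (f.comp e) (g.comp r)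
      (fun x => hf (r x)) y fun x hx => hy (r x) (by
        change e.symm (sphereToBall (m + 1) (r x)) 0 = 0 ∨
          Fin.tail (e.symm (sphereToBall (m + 1) (r x))) ∈ Cube.boundary (Fin m)
        rwa [hre, e.symm_apply_apply])
    have hmem : ∀ s, e.symm (sphereToBall (m + 1) s) ∈ Cube.boundary (Fin (m + 1)) := fun s =>
      (he _).2 ⟨s, (e.apply_symm_apply _).symm⟩
    refine ⟨G.comp e.symm, fun s => ?_, ⟨{
      toFun := fun x => H (x.1, e.symm x.2)
      continuous_toFun := by fun_prop
      map_zero_left := fun x => by simp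
      map_one_left := fun x => by simp
      prop' := ?_ }⟩⟩
    · refine (hG ⟨_, hmem s⟩).trans (congrArg g (Subtype.ext ?_))
      have h := congrArg Subtype.val (e.apply_symm_apply (sphereToBall (m + 1) s))
      exact h
    · rintro t _ ⟨s, rfl⟩
      refine (H.eq_fst t (hmem s)).trans ?_
      exact congrArg f (e.apply_symm_apply _)

section MappingPath

variable (M : Type u) [Monoid M] {Y Z : Type*} [TopologicalSpace Y] [TopologicalSpace Z]
  [MulAction M Y] [MulAction M Z] [ContinuousConstSMul M Z]

/-- The mapping path space of an equivariant map `k`: the space of points `y` with a path that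
ends in `k y`. -/
def MappingPath (k : C(Y, Z)) (hk : ∀ (m : M) (y : Y), k (m • y) = m • k y) :
    SubMulAction M (Y × C(I, Z)) where
  carrier := {w | w.2 1 = k w.1}
  smul_mem' m w hw := by
    change m • w.2 1 = k (m • w.1)
    rw [hk, ← hw]

variable {M} (k : C(Y, Z)) (hk : ∀ (m : M) (y : Y), k (m • y) = m • k y)

namespace MappingPath

/-- The starting point of the path. -/
def start : C(MappingPath M k hk, Z) :=
  ⟨fun w => w.1.2 0, by fun_prop⟩

theorem start_smul (m : M) (x : MappingPath M k hk) : start k hk (m • x) = m • start k hk x :=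
  rfl

theorem liftsCell_start {n : ℕ∞} (hn : IsNEquivalence n k) (q : ℕ) (hq : (q : ℕ∞) ≤ n) :
    LiftsCell (start k hk) q := by
  intro f u hfu
  cases q with
  | zero =>
    have hs : Function.Surjective (piZeroMap k) := by
      rcases eq_or_ne n 0 with h | h
      · exact hn.surjective_zero h
      · exact (hn.bijective_zero (pos_iff_ne_zero.2 h)).surjective
    let o : UnitBall 0 := ⟨0, Metric.mem_closedBall_self zero_le_one⟩
    obtain ⟨y, hy⟩ := hs ⟦f o⟧
    induction y using Quotient.inductionOn with
    | h y =>
      obtain ⟨γ⟩ : Joined (k y) (f o) := Quotient.exact hy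
      refine ⟨ContinuousMap.const _ ⟨(y, γ.symm.toContinuousMap), γ.symm.target⟩, fun s => ?_,
        fun b => ?_⟩
      · have := mem_sphere_zero_iff_norm.1 s.2
        rw [Subsingleton.elim (s : EuclideanSpace ℝ (Fin 0)) 0, norm_zero] at this
        exact absurd this zero_ne_one
      · rw [Subsingleton.elim b o]
        exact γ.symm.source
  | succ q =>
    obtain ⟨g', h', h1, h2, h3, h4⟩ := exists_homotopyExtensionLift_ball k (hn.relCompressible hq) f
      ⟨fun s => (u s).1.1, by fun_prop⟩ ⟨fun x => (u x.1).1.2 x.2, by fun_prop⟩ hfu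
      fun s => (u s).2
    refine ⟨⟨fun b => ⟨(g' b, h'.curry b), h4 b⟩,
      (g'.continuous.prodMk h'.curry.continuous).subtype_mk _⟩, fun s => ?_, h3⟩
    exact Subtype.ext (Prod.ext (h1 s) (ContinuousMap.ext (h2 s)))

end MappingPath

end MappingPath

theorem theoremt {M : Type u} [Monoid M]
    {X Y Z : Type*} [TopologicalSpace X] [TopologicalSpace Y] [TopologicalSpace Z]
    [MulAction M X] [MulAction M Y] [MulAction M Z]
    [ContinuousConstSMul M X] [ContinuousConstSMul M Y] [ContinuousConstSMul M Z]
    (A : SubMulAction M X) (K : ProjectiveRelCW.{_, _, w} M X A) (n : ℕ∞) (hK : K.DimLE n)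
    (k : C(Y, Z)) (hk_equivariant : ∀ (m : M) (y : Y), k (m • y) = m • k y)
    (hk : IsNEquivalence n k)
    (f : C(X, Z)) (hf : ∀ (m : M) (x : X), f (m • x) = m • f x)
    (g : C(A, Y)) (hg : ∀ (m : M) (a : A), g (m • a) = m • g a)
    (h : C(A × I, Z)) (hh : ∀ (m : M) (a : A) (t : I), h (m • a, t) = m • h (a, t))
    (hkg : ∀ a : A, k (g a) = h (a, 1)) (hfi : ∀ a : A, f a = h (a, 0)) :
    ∃ (g' : C(X, Y)) (h' : C(X × I, Z)),
      (∀ (m : M) (x : X), g' (m • x) = m • g' x) ∧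
      (∀ (m : M) (x : X) (t : I), h' (m • x, t) = m • h' (x, t)) ∧
      (∀ a : A, g' a = g a) ∧
      (∀ (a : A) (t : I), h' (a, t) = h (a, t)) ∧
      (∀ x : X, h' (x, 0) = f x) ∧
      (∀ x : X, h' (x, 1) = k (g' x)) := by
  let V := MappingPath M k hk_equivariant
  have hV : ContinuousConstSMul M V :=
    ⟨fun m => (continuous_subtype_val.const_smul m).subtype_mk _⟩
  let u : C(A, V) := ⟨fun a => ⟨(g a, h.curry a), (hkg a).symm⟩,
    (g.continuous.prodMk h.curry.continuous).subtype_mk _⟩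
  have hl : ∀ q, Nonempty (K.cell q) → LiftsCell (MappingPath.start k hk_equivariant) q :=
    fun q ⟨c⟩ => MappingPath.liftsCell_start k hk_equivariant hk q
      (not_lt.1 fun hq => (hK q hq).elim c)
  obtain ⟨U, hU1, hU2, hU3⟩ := K.exists_lift (MappingPath.start k hk_equivariant)
    (MappingPath.start_smul k hk_equivariant) hl f hf u
    (fun m a => Subtype.ext (Prod.ext (hg m a) (ContinuousMap.ext (hh m a))))
    fun a => (hfi a).symm
  refine ⟨⟨fun x => (U x).1.1, by fun_prop⟩, ⟨fun x => (U x.1).1.2 x.2, by fun_prop⟩,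
    fun m x => ?_, fun m x t => ?_, fun a => ?_, fun a t => ?_, hU2, fun x => (U x).2⟩
  · exact congrArg (fun w : V => w.1.1) (hU1 m x)
  · exact congrArg (fun w : V => w.1.2 t) (hU1 m x)
  · exact congrArg (fun w : V => w.1.1) (hU3 a)
  · exact congrArg (fun w : V => w.1.2 t) (hU3 a)
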